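/- Let $\mathbb F$ be a field and $d\ge 1$. An element $g\in GL(d,\mathbb F)$ is unipotent if some positive power of $g-I$ is zero (equivalently, all its eigenvalues over the algebraic closure of $\mathbb F$ equal $1$). A subgroup of $GL(d,\mathbb F)$ is NIU-linear if every unipotent element of it has finite order; an abstract group $G$ is NIU-linear if, for some field $\mathbb F$ of arbitrary characteristic and some $d\ge 1$, it has a faithful representation $\rho:G\to GL(d,\mathbb F)$ whose image is NIU-linear. For a finite generating set $S$ of a group $G$, let $l_S(g)$ be the word length of $g\in G$, i.e. the least $n\ge 0$ such that $g$ is a product of $n$ elements of $S\cup S^{-1}$. A finitely generated subgroup $A$ of a finitely generated group $G$ is undistorted in $G$ if for every finite generating set $S$ of $G$ and every finite generating set $T$ of $A$ there is a constant $C>0$ such that $l_T(a)\le C\,l_S(a)$ for all $a\in A$ (the choice of $S$ and $T$ does not matter). **Theorem.** Let $G$ be a finitely generated NIU-linear group and let $A$ be any finitely generated abelian subgroup of $G$. Then $A$ is undistorted in $G$. -/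

import Mathlib

universe u v

namespace NIU

/-- An element `g` of `GL(d, F)` is unipotent if some power of `g - I` is the zero matrix
(equivalently, all its eigenvalues over the algebraic closure of `F` are equal to `1`). -/
def IsUnipotent {F : Type v} [Field F] {d : ℕ} (g : GL (Fin d) F) : Prop :=
  IsNilpotent ((g : Matrix (Fin d) (Fin d) F) - 1)

/-- A subgroup of `GL(d, F)` is NIU-linear if each of its unipotent elements has finite order. -/
def IsNIULinearSubgroup {F : Type v} [Field F] {d : ℕ} (H : Subgroup (GL (Fin d) F)) : Prop :=
  ∀ g ∈ H, IsUnipotent g → IsOfFinOrder g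

/-- An abstract group is NIU-linear if, for some field `F` and some dimension `d ≥ 1`, it has a
faithful representation in `GL(d, F)` whose image is NIU-linear. -/
def IsNIULinear (G : Type u) [Group G] : Prop :=
  ∃ (F : Type v) (_ : Field F) (d : ℕ) (ρ : G →* GL (Fin d) F),
    0 < d ∧ Function.Injective ρ ∧ IsNIULinearSubgroup ρ.range

/-- The word length of `g` with respect to `S`: the least `n` such that `g` is a product of `n`
elements of `S ∪ S⁻¹`. It is only used for generating sets `S`. -/
noncomputable def wordLength {G : Type u} [Group G] (S : Set G) (g : G) : ℕ :=
  sInf {n : ℕ | ∃ l : List G, (∀ x ∈ l, x ∈ S ∨ x⁻¹ ∈ S) ∧ l.prod = g ∧ l.length = n}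

/-- For a generating set, the infimum in `wordLength` is attained. -/
theorem exists_list_length_eq_wordLength {G : Type u} [Group G] {S : Set G}
    (hS : Subgroup.closure S = ⊤) (g : G) :
    ∃ l : List G, (∀ x ∈ l, x ∈ S ∨ x⁻¹ ∈ S) ∧ l.prod = g ∧ l.length = wordLength S g := by
  have hg : g ∈ Subgroup.closure S := by rw [hS]; exact Subgroup.mem_top g
  rw [← Subgroup.mem_toSubmonoid, Subgroup.closure_toSubmonoid] at hg
  obtain ⟨l, hl, hp⟩ := Submonoid.exists_list_of_mem_closure hg
  exact Nat.sInf_mem (s := {n : ℕ | ∃ l : List G,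
    (∀ x ∈ l, x ∈ S ∨ x⁻¹ ∈ S) ∧ l.prod = g ∧ l.length = n}) ⟨l.length, l, hl, hp, rfl⟩

/-- A finitely generated subgroup `A` of a finitely generated group `G` is undistorted in `G` if,
for all finite generating sets `S` of `G` and `T` of `A`, the word length on `A` with respect to
`T` is bounded by a constant multiple of the restriction to `A` of the word length on `G` with
respect to `S`. -/
def IsUndistorted {G : Type u} [Group G] (A : Subgroup G) : Prop :=
  ∀ S : Set G, S.Finite → Subgroup.closure S = ⊤ →
    ∀ T : Set A, T.Finite → Subgroup.closure T = ⊤ →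
      ∃ C : ℝ, 0 < C ∧ ∀ a : A, (wordLength T a : ℝ) ≤ C * (wordLength S (a : G) : ℝ)

end NIU

/-! The heart is a uniform lower bound `m ≤ N * wordLength S (g ^ m)` for all `g` of infinite order
(`exists_le_mul_wordLength_pow`). Restriction of scalars moves the representation to `E`, the
fraction field of a polynomial ring `P` over `ℤ` or `ZMod p`. Let `f` be a common denominator of the
generators. If powers of `a` have word length at most `m / N`, then `f ^ L • a ^ m` is a product of
`L ≤ m / N` matrices from a finite set over `P`. For `N` large this forces `a.charpoly` into a
finite set independent of `a`: its coefficients have no denominators, and are then constants from a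
finite set, by comparing degrees of `p`-power powers in characteristic `p`
(`exists_finite_charpoly_of_charP`), and by bounding eigenvalues at integer points in characteristic
zero (`exists_finite_charpoly_of_int`).

If the bound fails for `g`, it fails well enough that many powers `g ^ j` are slow at once, so two
of them share a characteristic polynomial. The eigenvalues are then roots of unity, some power of
`g` is unipotent, and the NIU hypothesis makes `g` of finite order.

Positivity on each infinite-order element does not by itself bound a length on `ℤ^J` below by a
norm, but the uniform bound does: by Dirichlet approximation a small multiple of any vector is close
to a large multiple of a nonzero lattice vector (`exists_natAbs_le_mul`). The structure theorem for
finitely generated abelian groups finishes the proof. -/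

namespace NIU

open Polynomial

/-! ### Characteristic polynomials of powers and scalar multiples. -/

section Charpoly

variable {R : Type*} [CommRing R] {n : Type*} [Fintype n] [DecidableEq n]

/-- This puts `X ^ m - M ^ m` under a determinant, where it can be factored: `X - M` always divides
it, and in characteristic `p` with `m = p` it equals `(X - M) ^ p`. -/
theorem det_scalar_X_pow_sub_C_mapMatrix_pow (M : Matrix n n R) (m : ℕ) :
    (Matrix.scalar n (X : R[X]) ^ m - (C.mapMatrix M) ^ m).det =
      expand R m (M ^ m).charpoly := by
  rw [Matrix.charpoly, Matrix.charmatrix, AlgHom.map_det]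
  congr 1
  rw [map_sub, ← map_pow, ← map_pow]
  congr 1
  · ext i j
    by_cases h : i = j <;> simp [Matrix.scalar_apply, h]
  · ext i j
    simp

/-- The characteristic polynomial of `M` divides that of `M ^ m` evaluated at `X ^ m`. -/
theorem charpoly_dvd_expand_charpoly_pow (M : Matrix n n R) (m : ℕ) :
    M.charpoly ∣ expand R m (M ^ m).charpoly := by
  have hc : Commute (Matrix.scalar n (X : R[X])) (C.mapMatrix M) :=
    Matrix.scalar_commute _ (fun r => Commute.all _ _) _
  have h := hc.sub_dvd_pow_sub_pow m
  obtain ⟨c, hc⟩ := h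
  rw [← det_scalar_X_pow_sub_C_mapMatrix_pow, hc, Matrix.det_mul]
  exact Dvd.intro _ rfl

theorem charpoly_pow_char (p : ℕ) [Fact p.Prime] [CharP R p] (M : Matrix n n R) :
    (M ^ p).charpoly = M.charpoly.map (frobenius R p) := by
  have hp := (Fact.out : p.Prime)
  have hc : Commute (Matrix.scalar n (X : R[X])) (C.mapMatrix M) :=
    Matrix.scalar_commute _ (fun r => Commute.all _ _) _
  apply expand_injective hp.pos
  rw [← det_scalar_X_pow_sub_C_mapMatrix_pow]
  cases isEmpty_or_nonempty n
  · simp [Matrix.charpoly]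
  · rw [← sub_pow_char_of_commute p hc, Matrix.det_pow, ← map_expand, map_frobenius_expand]
    rfl

theorem charpoly_pow_char_pow (p : ℕ) [Fact p.Prime] [CharP R p] (M : Matrix n n R) (s i : ℕ) :
    (M ^ p ^ s).charpoly.coeff i = M.charpoly.coeff i ^ p ^ s := by
  induction s with
  | zero => simp
  | succ s ih =>
    rw [pow_succ, pow_mul, charpoly_pow_char, coeff_map, ih, frobenius_def, ← pow_mul]

/-- Substituting `y * X` pulls `y` out of the characteristic matrix of `y • M`, so no invertibility
of `y` is needed. -/
theorem charpoly_smul_comp (y : R) (M : Matrix n n R) :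
    (y • M).charpoly.comp (C y * X) = C (y ^ Fintype.card n) * M.charpoly := by
  have h1 : (compRingHom (C y * X)).mapMatrix (y • M).charmatrix = C y • M.charmatrix := by
    ext1 i j
    by_cases h : i = j
    · subst h
      simp [mul_sub]
    · simp [h]
  have h2 : (y • M).charpoly.comp (C y * X) =
      compRingHom (C y * X) (y • M).charmatrix.det := by
    rw [coe_compRingHom_apply]; rfl
  rw [h2, RingHom.map_det, h1, Matrix.det_smul, map_pow]
  rfl

theorem coeff_charpoly_smul (y : R) (M : Matrix n n R) (i : ℕ) :
    (y • M).charpoly.coeff i * y ^ i = y ^ Fintype.card n * M.charpoly.coeff i := by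
  rw [← comp_C_mul_X_coeff, charpoly_smul_comp, coeff_C_mul]

/-- If some positive power of `M` has integral entries, so do the coefficients of its
characteristic polynomial. -/
theorem isIntegral_coeff_charpoly_of_pow {P : Type*} [CommRing P] [Algebra P R]
    (M : Matrix n n R) {m : ℕ} (hm : 0 < m)
    (h : ∀ i j, IsIntegral P ((M ^ m) i j)) (i : ℕ) :
    IsIntegral P (M.charpoly.coeff i) := by
  let O := integralClosure P R
  let B : Matrix n n O := Matrix.of fun i j => ⟨(M ^ m) i j, h i j⟩
  have hB : B.map (algebraMap O R) = M ^ m := by ext i j; rfl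
  have hd := charpoly_dvd_expand_charpoly_pow M m
  rw [← hB, Matrix.charpoly_map, ← map_expand] at hd
  have := isIntegral_coeff_of_dvd (expand O m B.charpoly) M.charpoly
    ((Matrix.charpoly_monic _).expand hm) (Matrix.charpoly_monic _) hd i
  exact isIntegral_trans _ this

end Charpoly

/-! ### Slow growth excludes denominators in the characteristic polynomial. -/

section Denominators

theorem exists_isUnit_of_pow_dvd {P : Type*} [CommRing P] [UniqueFactorizationMonoid P] {a : P} (ha : a ≠ 0) :
    ∃ N : ℕ, 0 < N ∧ ∀ M, N ≤ M → ∀ v : P, v ^ M ∣ a → IsUnit v := by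
  classical
  refine ⟨Multiset.card (UniqueFactorizationMonoid.factors a) + 1, by omega, fun M hM v hv => ?_⟩
  have hv0 : v ≠ 0 := by
    rintro rfl
    rw [zero_pow (by omega), zero_dvd_iff] at hv
    exact ha hv
  by_contra hu
  obtain ⟨q, hq, hqv⟩ := WfDvdMonoid.exists_irreducible_factor hu hv0
  have h1 : q ^ M ∣ a := (pow_dvd_pow_of_dvd hqv M).trans hv
  let := UniqueFactorizationMonoid.strongNormalizationMonoid (α := P)
  have h2 := Multiset.card_le_card <|
    (UniqueFactorizationMonoid.le_emultiplicity_iff_replicate_le_normalizedFactors hq ha).1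
      (le_emultiplicity_of_pow_dvd h1)
  rw [Multiset.card_replicate, UniqueFactorizationMonoid.normalizedFactors,
    Multiset.card_map] at h2
  omega

variable {P E : Type*} [CommRing P] [IsDomain P] [UniqueFactorizationMonoid P] [Field E]
  [Algebra P E] [IsFractionRing P E] {n : Type*} [Fintype n] [DecidableEq n]

/-- In lowest terms the `N`-th power of the denominator of `c` is prime to the numerator, so it
divides `a`; hence the denominator is a unit. -/
theorem isInteger_of_mul_pow {a : P} {N : ℕ} (ha : ∀ v : P, v ^ N ∣ a → IsUnit v)
    {c : E} {r : P} (h : algebraMap P E a * c ^ N = algebraMap P E r) :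
    ∃ r, algebraMap P E r = c := by
  apply IsFractionRing.isInteger_of_isUnit_den
  apply ha
  have hd : algebraMap P E (IsFractionRing.den P c) ≠ 0 := by
    simp
  have hc : c = algebraMap P E (IsFractionRing.num P c) / algebraMap P E (IsFractionRing.den P c) := by
    exact (IsFractionRing.mk'_num_den' P c).symm
  have h1 : a * IsFractionRing.num P c ^ N = r * IsFractionRing.den P c ^ N := by
    apply IsFractionRing.injective P E
    rw [hc, div_pow] at h
    field_simp at h
    rw [mul_comm r]
    simpa using h
  have h2 : IsRelPrime (IsFractionRing.den P c : P) (IsFractionRing.num P c) :=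
    (IsFractionRing.num_den_reduced P c).symm
  exact (h2.pow).dvd_of_dvd_mul_right (h1.symm ▸ Dvd.intro_left _ rfl)

/-- Since `L ≤ m / N`, each factor `a` costs at most an `N`-th root of `f` in denominators. For
large `N` this is too little for a genuine denominator to survive in the unique factorization domain
`P`. -/
theorem exists_map_eq_charpoly {f : P} (hf : f ≠ 0) {N : ℕ} (hN : 0 < N)
    (hfN : ∀ v : P, v ^ N ∣ f ^ Fintype.card n → IsUnit v) {a : Matrix n n E} {B : Matrix n n P}
    {L m : ℕ} (hm : 0 < m) (hL : N * L ≤ m)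
    (h : algebraMap P E f ^ L • a ^ m = B.map (algebraMap P E)) :
    ∃ q : P[X], q.map (algebraMap P E) = a.charpoly := by
  let K := AlgebraicClosure E
  -- With `y ^ N = f`, the matrix `(y • a) ^ m` equals `y ^ (m - N * L)` times an integral matrix.
  obtain ⟨y, hy⟩ := IsAlgClosed.exists_pow_nat_eq (algebraMap P K f) hN
  have hy0 : y ≠ 0 := by
    rintro rfl
    rw [zero_pow hN.ne', IsScalarTower.algebraMap_apply P E K, eq_comm, map_eq_zero,
      map_eq_zero_iff _ (IsFractionRing.injective P E)] at hy
    exact hf hy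
  have hyi : IsIntegral P y := IsIntegral.of_pow hN (hy ▸ isIntegral_algebraMap)
  let b := a.map (algebraMap E K)
  have hb : ∀ i j, IsIntegral P (((y • b) ^ m) i j) := by
    intro i j
    have h1 : (y • b) ^ m = y ^ (m - N * L) • B.map (algebraMap P K) := by
      have h2 : B.map (algebraMap P K) = (B.map (algebraMap P E)).map (algebraMap E K) := by
        ext; simp [← IsScalarTower.algebraMap_apply]
      rw [h2, ← h, _root_.smul_pow]
      have h3 : y ^ m = y ^ (m - N * L) * algebraMap P K f ^ L := by
        rw [← hy, ← pow_mul, ← pow_add]; congr 1; omega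
      have h4 : (algebraMap P E f ^ L • a ^ m).map (algebraMap E K) =
          algebraMap P K f ^ L • b ^ m := by
        have : b ^ m = (a ^ m).map (algebraMap E K) :=
          (map_pow (algebraMap E K).mapMatrix a m).symm
        rw [this]
        ext
        simp [IsScalarTower.algebraMap_apply P E K]
      rw [h4, h3, mul_smul]
    rw [h1]
    exact (hyi.pow _).mul isIntegral_algebraMap
  have hc : ∀ i, ∃ r : P, algebraMap P E r = a.charpoly.coeff i := by
    intro i
    have h1 := isIntegral_coeff_charpoly_of_pow (P := P) (y • b) hm hb i
    have h2 := coeff_charpoly_smul y b i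
    have h3 : IsIntegral P (y ^ Fintype.card n * b.charpoly.coeff i) := h2 ▸ h1.mul (hyi.pow _)
    have h4 : (y ^ Fintype.card n * b.charpoly.coeff i) ^ N =
        algebraMap E K (algebraMap P E (f ^ Fintype.card n) * a.charpoly.coeff i ^ N) := by
      rw [mul_pow, ← pow_mul, mul_comm _ N, pow_mul, hy, Matrix.charpoly_map, coeff_map]
      simp [IsScalarTower.algebraMap_apply P E K]
    -- The `N`-th power removes the root `y` and descends to `E`, where integral elements lie in
    -- `P`.
    have h5 := h3.pow N
    rw [h4, isIntegral_algebraMap_iff (algebraMap E K).injective] at h5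
    obtain ⟨r, hr⟩ := (IsIntegrallyClosed.isIntegral_iff).1 h5
    exact isInteger_of_mul_pow hfN hr.symm
  choose r hr using hc
  refine ⟨∑ i ∈ a.charpoly.support, monomial i (r i), ?_⟩
  rw [Polynomial.map_sum]
  simp only [map_monomial, hr]
  exact a.charpoly.as_sum_support.symm

end Denominators

end NIU

namespace NIU

open Polynomial

/-- The polynomials of bounded degree with coefficients in a finite set form a finite set. -/
theorem finite_setOf_coeff_mem {R : Type*} [Semiring R] (d : ℕ) {s : Set R} (hs : s.Finite) :
    {q : R[X] | q.natDegree ≤ d ∧ ∀ i, q.coeff i ∈ s}.Finite := by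
  have h : Set.Finite {c : Fin (d + 1) → R | ∀ i, c i ∈ s} := Set.Finite.pi' fun _ => hs
  refine Set.Finite.of_finite_image (f := fun (q : R[X]) (i : Fin (d + 1)) => q.coeff i) (h.subset ?_) ?_
  · rintro _ ⟨q, hq, rfl⟩ i
    exact hq.2 i
  · intro q hq r hr hqr
    ext i
    by_cases hi : i ≤ d
    · exact congrFun hqr ⟨i, by omega⟩
    · rw [coeff_eq_zero_of_natDegree_lt, coeff_eq_zero_of_natDegree_lt]
      · exact hr.1.trans_lt (by omega)
      · exact hq.1.trans_lt (by omega)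

/-- For all large `m` there is an `L ≤ m / N` such that `f ^ L • a ^ m` is a product of `L`
matrices from `s`. -/
def SlowPowers {P E : Type*} [CommRing P] [Field E] [Algebra P E] {n : Type*} [Fintype n]
    [DecidableEq n] (f : P) (s : Set (Matrix n n P)) (N : ℕ) (a : Matrix n n E) : Prop :=
  ∀ᶠ m in Filter.atTop, ∃ l : List (Matrix n n P), (∀ x ∈ l, x ∈ s) ∧ N * l.length ≤ m ∧
    algebraMap P E f ^ l.length • a ^ m = l.prod.map (algebraMap P E)

/-! ### Finitely many characteristic polynomials: characteristic `p`. -/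

section CharP

variable {σ k : Type*} [CommRing k] {n : Type*} [Fintype n] [DecidableEq n]

theorem totalDegree_coeff_prod_le {ι : Type*} (s : Finset ι) (q : ι → (MvPolynomial σ k)[X])
    {D : ℕ} (hq : ∀ i ∈ s, ∀ j, ((q i).coeff j).totalDegree ≤ D) (j : ℕ) :
    ((∏ i ∈ s, q i).coeff j).totalDegree ≤ s.card * D := by
  classical
  induction s using Finset.induction_on generalizing j with
  | empty =>
    simp only [Finset.prod_empty, coeff_one]
    split_ifs <;> simp
  | insert a s ha ih =>
    rw [Finset.prod_insert ha, coeff_mul, Finset.card_insert_of_notMem ha]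
    refine MvPolynomial.totalDegree_finsetSum_le fun x _ => ?_
    refine (MvPolynomial.totalDegree_mul _ _).trans ?_
    have h1 := hq a (by simp) x.1
    have h2 := ih (fun i hi => hq i (by simp [hi])) x.2
    linarith

theorem totalDegree_coeff_charpoly_le (M : Matrix n n (MvPolynomial σ k)) {D : ℕ}
    (hM : ∀ i j, (M i j).totalDegree ≤ D) (i : ℕ) :
    (M.charpoly.coeff i).totalDegree ≤ Fintype.card n * D := by
  rw [Matrix.charpoly, Matrix.det_apply, finsetSum_coeff]
  refine MvPolynomial.totalDegree_finsetSum_le fun π _ => ?_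
  rw [coeff_smul]
  refine le_trans ?_ (totalDegree_coeff_prod_le Finset.univ (fun j => M.charmatrix (π j) j)
    (D := D) ?_ i)
  · rcases Int.units_eq_one_or (Equiv.Perm.sign π) with h | h <;> simp [h]
  · intro j _ t
    by_cases h : π j = j
    · rw [h, Matrix.charmatrix_apply_eq, coeff_sub, coeff_X, coeff_C]
      refine (MvPolynomial.totalDegree_sub _ _).trans (max_le ?_ ?_)
      · split_ifs <;> simp
      · split_ifs <;> simp [hM]
    · rw [Matrix.charmatrix_apply_ne _ _ _ h, coeff_neg, coeff_C, MvPolynomial.totalDegree_neg]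
      split_ifs <;> simp [hM]

theorem totalDegree_list_prod_le {s : Set (Matrix n n (MvPolynomial σ k))} {D : ℕ}
    (hs : ∀ M ∈ s, ∀ i j, (M i j).totalDegree ≤ D) (l : List (Matrix n n (MvPolynomial σ k)))
    (hl : ∀ x ∈ l, x ∈ s) (i j : n) : (l.prod i j).totalDegree ≤ l.length * D := by
  induction l generalizing i j with
  | nil =>
    simp only [List.prod_nil, Matrix.one_apply]
    split_ifs <;> simp
  | cons a l ih =>
    rw [List.prod_cons, Matrix.mul_apply, List.length_cons]
    refine MvPolynomial.totalDegree_finsetSum_le fun x _ => ?_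
    refine (MvPolynomial.totalDegree_mul _ _).trans ?_
    have h1 := hs a (hl a (by simp)) i x
    have h2 := ih (fun y hy => hl y (by simp [hy])) x j
    linarith

theorem exists_totalDegree_le {n : Type*} [Fintype n] {s : Set (Matrix n n (MvPolynomial σ k))} (hs : s.Finite) :
    ∃ D, ∀ M ∈ s, ∀ i j, (M i j).totalDegree ≤ D := by
  obtain ⟨D, hD⟩ := (hs.image fun M => ∑ i, ∑ j, (M i j).totalDegree).bddAbove
  refine ⟨D, fun M hM i j => le_trans ?_ (hD ⟨M, hM, rfl⟩)⟩
  exact (Finset.single_le_sum (f := fun j => (M i j).totalDegree) (fun _ _ => Nat.zero_le _)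
    (Finset.mem_univ j)).trans (Finset.single_le_sum (f := fun i => ∑ j, (M i j).totalDegree)
      (fun _ _ => Nat.zero_le _) (Finset.mem_univ i))

theorem totalDegree_pow_of_isDomain [IsDomain k] {f : MvPolynomial σ k} (hf : f ≠ 0) (m : ℕ) :
    (f ^ m).totalDegree = m * f.totalDegree := by
  induction m with
  | zero => simp
  | succ m ih =>
    rw [pow_succ, MvPolynomial.totalDegree_mul_of_isDomain (pow_ne_zero _ hf) hf, ih]
    ring

/-- Frobenius turns a coefficient `c` for `a` into `c ^ p ^ s` for `a ^ p ^ s`, multiplying its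
degree by `p ^ s`. A product of `L ≤ p ^ s / N` matrices of bounded degree cannot reach this unless
`c` has degree zero, and the constants form the finite ring `k`. -/
theorem exists_finite_charpoly_of_charP [IsDomain k] [IsPrincipalIdealRing k] [Finite k]
    (p : ℕ) [Fact p.Prime] [CharP k p]
    {E : Type*} [Field E] [Algebra (MvPolynomial σ k) E] [IsFractionRing (MvPolynomial σ k) E]
    {f : MvPolynomial σ k} (hf : f ≠ 0) {s : Set (Matrix n n (MvPolynomial σ k))}
    (hs : s.Finite) :
    ∃ N : ℕ, 0 < N ∧ ∃ 𝓛 : Set E[X], 𝓛.Finite ∧ ∀ a : Matrix n n E,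
      SlowPowers f s N a → a.charpoly ∈ 𝓛 := by
  let P := MvPolynomial σ k
  obtain ⟨N, hN, hfN⟩ := exists_isUnit_of_pow_dvd (pow_ne_zero (Fintype.card n) hf)
  obtain ⟨D, hD⟩ := exists_totalDegree_le hs
  have : CharP E p := by
    have := charP_of_injective_algebraMap (IsFractionRing.injective P E) p
    exact this
  -- The first summand gives integrality; the second exceeds the degree gained per factor, counting
  -- the powers of `f`.
  refine ⟨N + Fintype.card n * (D + f.totalDegree), by omega,
    {q | q.natDegree ≤ Fintype.card n ∧
      ∀ i, q.coeff i ∈ Set.range ((algebraMap P E).comp MvPolynomial.C)},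
    finite_setOf_coeff_mem _ (Set.finite_range _), fun a ha => ⟨?_, fun i => ?_⟩⟩
  · rw [Matrix.charpoly_natDegree_eq_dim]
  obtain ⟨m₀, hm₀⟩ := Filter.eventually_atTop.1 ha
  have hp := (Fact.out : p.Prime)
  have hm₁ : m₀ ≤ p ^ m₀ := (Nat.lt_pow_self hp.one_lt).le
  obtain ⟨l, hl, hlN, hlp⟩ := hm₀ _ hm₁
  obtain ⟨q, hq⟩ := exists_map_eq_charpoly hf hN (hfN N le_rfl) (pow_pos hp.pos _)
    (le_trans (Nat.mul_le_mul_right _ (by omega)) hlN) hlp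
  have h1 := coeff_charpoly_smul (algebraMap P E f ^ l.length) (a ^ p ^ m₀) i
  rw [hlp, charpoly_pow_char_pow, ← hq, Matrix.charpoly_map, coeff_map, coeff_map,
    ← map_pow, ← map_pow, ← map_pow, ← map_pow, ← map_mul, ← map_mul] at h1
  replace h1 := IsFractionRing.injective P E h1
  have h2 : (q.coeff i).totalDegree = 0 := by
    by_cases hi : Fintype.card n < i
    · have : q.natDegree = Fintype.card n := by
        rw [← natDegree_map_eq_of_injective (IsFractionRing.injective P E), hq,
          Matrix.charpoly_natDegree_eq_dim]
      rw [coeff_eq_zero_of_natDegree_lt (by omega)]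
      simp
    push Not at hi
    by_contra h0
    have h3 : q.coeff i ≠ 0 := by
      intro h
      simp [h] at h0
    have h4 := congrArg MvPolynomial.totalDegree h1
    rw [MvPolynomial.totalDegree_mul_of_isDomain (pow_ne_zero _ (pow_ne_zero _ hf)) (pow_ne_zero _ h3),
      totalDegree_pow_of_isDomain h3] at h4
    have h5 := totalDegree_coeff_charpoly_le l.prod (totalDegree_list_prod_le hD l hl) i
    have h6 : p ^ m₀ * 1 ≤ p ^ m₀ * (q.coeff i).totalDegree :=
      Nat.mul_le_mul_left _ (Nat.one_le_iff_ne_zero.2 h0)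
    have h7 := MvPolynomial.totalDegree_mul (l.prod.charpoly.coeff i) ((f ^ l.length) ^ i)
    have h8 : ((f ^ l.length) ^ i).totalDegree ≤ Fintype.card n * (l.length * f.totalDegree) :=
      (MvPolynomial.totalDegree_pow _ _).trans
        (Nat.mul_le_mul hi (MvPolynomial.totalDegree_pow _ _))
    have h9 : p ^ m₀ ≤ Fintype.card n * (l.length * D) + Fintype.card n * (l.length * f.totalDegree) := by
      omega
    have h10 : 0 < l.length := by
      rcases Nat.eq_zero_or_pos l.length with h | h
      · simp [h] at h9
        exact absurd h9.1 hp.ne_zero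
      · exact h
    nlinarith [Nat.mul_pos hN h10]
  refine ⟨MvPolynomial.coeff 0 (q.coeff i), ?_⟩
  rw [RingHom.comp_apply, ← hq, coeff_map, ← MvPolynomial.totalDegree_eq_zero_iff_eq_C.1 h2]

end CharP

end NIU

namespace NIU

open Polynomial

/-! ### Growth of integer polynomials. -/

section Growth

theorem abs_eval_natCast_le (h : ℤ[X]) {e : ℕ} (he : h.natDegree ≤ e) (t : ℕ) :
    |((h.eval (t : ℤ) : ℤ) : ℝ)| ≤ (∑ i ∈ Finset.range (e + 1), |(h.coeff i : ℝ)|) * (1 + t) ^ e := by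
  rw [eval_eq_sum_range' (Nat.lt_succ_of_le he), Finset.sum_mul]
  push_cast
  refine (Finset.abs_sum_le_sum_abs _ _).trans (Finset.sum_le_sum fun i hi => ?_)
  rw [abs_mul, abs_of_nonneg (by positivity : (0 : ℝ) ≤ (t : ℝ) ^ i)]
  gcongr
  have h1 : i ≤ e := by simpa [Nat.lt_succ_iff] using hi
  calc (t : ℝ) ^ i ≤ (1 + t) ^ i := by gcongr; linarith
    _ ≤ (1 + t) ^ e := by gcongr; linarith [(Nat.cast_nonneg t : (0 : ℝ) ≤ t)]

/-- An integer polynomial whose `N`-th power is `O(t ^ e)` with `e < N` is constant. -/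
theorem natDegree_eq_zero_of_pow_le (h : ℤ[X]) {e N : ℕ} (he : e < N) (K : ℝ)
    (hK : ∀ᶠ t : ℕ in Filter.atTop, |((h.eval (t : ℤ) : ℤ) : ℝ)| ^ N ≤ K * (1 + t) ^ e) :
    h.natDegree = 0 := by
  by_contra hd
  have h0 : h ≠ 0 := by rintro rfl; simp at hd
  let H : ℝ[X] := (h.map (Int.castRingHom ℝ)) ^ N
  let G : ℝ[X] := C K * (1 + X) ^ e
  have hH0 : H ≠ 0 := pow_ne_zero _ ((Polynomial.map_ne_zero_iff (Int.cast_injective)).2 h0)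
  have hHd : N ≤ H.natDegree := by
    rw [natDegree_pow, natDegree_map_eq_of_injective Int.cast_injective]
    exact Nat.le_mul_of_pos_right _ (Nat.pos_of_ne_zero hd)
  have hGd : G.natDegree ≤ e := by
    refine (natDegree_C_mul_le _ _).trans ((natDegree_pow_le).trans ?_)
    have : (1 + X : ℝ[X]).natDegree ≤ 1 := by
      refine (natDegree_add_le _ _).trans (by simp)
    nlinarith
  have hlt : G.degree < H.degree := by
    rw [degree_eq_natDegree hH0]
    exact degree_le_natDegree.trans_lt (by exact_mod_cast lt_of_le_of_lt hGd (he.trans_le hHd))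
  have ht := (div_tendsto_atTop_zero_of_degree_lt G H hlt).comp tendsto_natCast_atTop_atTop
  have h1 : ∀ᶠ t : ℕ in Filter.atTop, H.eval (t : ℝ) ≠ 0 := by
    exact (tendsto_natCast_atTop_atTop (R := ℝ)).eventually (eventually_atTop_not_isRoot H hH0)
  have h2 := ht.abs.eventually_lt_const (by simp : |(0 : ℝ)| < 1)
  obtain ⟨t, ht1, ht2, ht3⟩ := (h1.and (h2.and hK)).exists
  have hHe : H.eval (t : ℝ) = ((h.eval (t : ℤ) : ℤ) : ℝ) ^ N := by
    have := eval_intCast_map (Int.castRingHom ℝ) h t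
    simp only [Int.cast_natCast, eq_intCast] at this
    rw [eval_pow, this]
  have hGe : G.eval (t : ℝ) = K * (1 + t) ^ e := by simp [G]
  rw [Function.comp_apply, abs_div, div_lt_one (abs_pos.2 ht1), hHe, hGe, abs_pow] at ht2
  exact absurd (ht2.trans_le ht3) (not_lt.2 (le_abs_self _))

end Growth

/-! ### Eigenvalue bounds after specialization to `ℂ`. -/

section RootBound

variable {P E : Type*} [CommRing P] [Field E] [Algebra P E] {n : Type*} [Fintype n]
  [DecidableEq n]

theorem dvd_expand_comp_of_smul_pow_eq (hPE : Function.Injective (algebraMap P E)) {y : P}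
    {a : Matrix n n E} {B : Matrix n n P} {m : ℕ} (h : algebraMap P E y • a ^ m = B.map (algebraMap P E))
    {q : P[X]} (hq : q.map (algebraMap P E) = a.charpoly) :
    q ∣ expand P m (B.charpoly.comp (C y * X)) := by
  have hqm : q.Monic := (Function.Injective.monic_map_iff hPE).2 (hq ▸ Matrix.charpoly_monic a)
  rw [← map_dvd_map _ hPE hqm, hq, map_expand, Polynomial.map_comp, ← Matrix.charpoly_map, ← h]
  simp only [Polynomial.map_mul, map_C, map_X]
  rw [charpoly_smul_comp, map_mul]
  exact (charpoly_dvd_expand_charpoly_pow a m).mul_left _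

attribute [local instance] Matrix.linftyOpNormedRing Matrix.linftyOpNormedAlgebra

theorem norm_le_linfty_of_isRoot_charpoly (M : Matrix n n ℂ) {μ : ℂ} (h : M.charpoly.IsRoot μ) :
    ‖μ‖ ≤ ‖M‖ := by
  have h1 := Matrix.mem_spectrum_of_isRoot_charpoly h
  have : CompleteSpace (Matrix n n ℂ) := FiniteDimensional.complete ℂ _
  have h2 := spectrum.norm_le_norm_mul_of_mem h1
  cases isEmpty_or_nonempty n
  · simp [Matrix.charpoly] at h
  · simpa using h2

theorem linfty_norm_le_sum (M : Matrix n n ℂ) : ‖M‖ ≤ ∑ i, ∑ j, ‖M i j‖ := by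
  rw [Matrix.linfty_opNorm_def]
  have h : (Finset.univ.sup fun i : n => ∑ j : n, ‖M i j‖₊) ≤ ∑ i, ∑ j, ‖M i j‖₊ :=
    Finset.sup_le fun i _ => Finset.single_le_sum (f := fun i => ∑ j, ‖M i j‖₊)
      (fun _ _ => zero_le) (Finset.mem_univ i)
  refine (NNReal.coe_le_coe.2 h).trans (le_of_eq ?_)
  push_cast
  rfl

/-- If `μ` is a root of the specialized polynomial, `θ f ^ L * μ ^ m` is an eigenvalue of a product
of `L` matrices of norm at most `K`. As `‖θ f‖ ≥ 1`, this gives `‖μ‖ ^ m ≤ K ^ L` with `N * L ≤ m`.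
-/
theorem norm_root_pow_le {f : P} {s : Set (Matrix n n P)}
    (hPE : Function.Injective (algebraMap P E)) (θ : P →+* ℂ) (hθf : 1 ≤ ‖θ f‖)
    {K : ℝ} (hK : 1 ≤ K) (hs : ∀ x ∈ s, ∑ i, ∑ j, ‖θ (x i j)‖ ≤ K) {N m : ℕ} (hm : 0 < m)
    {l : List (Matrix n n P)} (hl : ∀ x ∈ l, x ∈ s) (hN : N * l.length ≤ m) {a : Matrix n n E}
    (h : algebraMap P E f ^ l.length • a ^ m = l.prod.map (algebraMap P E))
    {q : P[X]} (hq : q.map (algebraMap P E) = a.charpoly) {μ : ℂ} (hμ : (q.map θ).IsRoot μ) :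
    ‖μ‖ ^ N ≤ K := by
  rw [← map_pow] at h
  obtain ⟨r, hr⟩ := dvd_expand_comp_of_smul_pow_eq hPE h hq
  have h1 : (l.prod.map θ).charpoly.IsRoot (θ f ^ l.length * μ ^ m) := by
    have := congrArg (fun q => (q.map θ).eval μ) hr
    simp only [Polynomial.map_mul, eval_mul, hμ.eq_zero, zero_mul] at this
    rw [map_expand, expand_eval, Polynomial.map_comp, eval_comp, ← Matrix.charpoly_map] at this
    simpa using this
  have h2 : ‖l.prod.map θ‖ ≤ K ^ l.length := by
    clear h1 hr h hN
    induction l with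
    | nil =>
      cases isEmpty_or_nonempty n
      · rw [Subsingleton.elim (Matrix.map _ _) 0]
        simp
      · simp
    | cons x l ih =>
      have h3 : ((x :: l).prod).map θ = x.map θ * l.prod.map θ := by
        rw [List.prod_cons, Matrix.map_mul]
      rw [h3, List.length_cons, pow_succ']
      refine (norm_mul_le _ _).trans (mul_le_mul ?_ ?_ (norm_nonneg _) (by linarith))
      · exact (linfty_norm_le_sum _).trans (hs x (hl x (by simp)))
      · exact ih (fun y hy => hl y (by simp [hy]))
  have h3 := (norm_le_linfty_of_isRoot_charpoly _ h1).trans h2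
  rw [norm_mul, norm_pow, norm_pow] at h3
  have h4 : ‖μ‖ ^ m ≤ K ^ l.length :=
    (le_mul_of_one_le_left (by positivity) (one_le_pow₀ hθf)).trans h3
  by_contra hc
  push Not at hc
  have h5 : 1 < ‖μ‖ := by
    by_contra h6
    have := pow_le_one₀ (norm_nonneg μ) (not_lt.1 h6) (n := N)
    linarith
  have h6 : (‖μ‖ ^ N) ^ l.length ≤ K ^ l.length := by
    rw [← pow_mul]
    exact (pow_le_pow_right₀ h5.le hN).trans h4
  rcases Nat.eq_zero_or_pos l.length with h7 | h7
  · rw [h7, pow_zero] at h4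
    exact absurd h4 (not_le.2 (one_lt_pow₀ h5 hm.ne'))
  · exact absurd h6 (not_le.2 (pow_lt_pow_left₀ hc (by linarith) h7.ne'))

end RootBound

/-! ### Finitely many characteristic polynomials: characteristic zero. -/

section CharZero

variable {σ : Type*} {n : Type*} [Fintype n] [DecidableEq n]

/-- Restriction of a polynomial to the line `z + X w`. -/
noncomputable def toLine (z w : σ → ℤ) : MvPolynomial σ ℤ →ₐ[ℤ] ℤ[X] :=
  MvPolynomial.aeval fun i => C (z i) + C (w i) * X

theorem eval_toLine (z w : σ → ℤ) (t : ℤ) (p : MvPolynomial σ ℤ) :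
    (toLine z w p).eval t = MvPolynomial.eval (fun i => z i + w i * t) p := by
  have : ((evalRingHom t).comp (toLine z w).toRingHom) =
      (MvPolynomial.eval (fun i => z i + w i * t)) := by
    apply MvPolynomial.ringHom_ext
    · intro r; simp [toLine]
    · intro i; simp [toLine]
  exact congrArg (fun θ => θ p) this

theorem natDegree_toLine_le (z w : σ → ℤ) (p : MvPolynomial σ ℤ) :
    (toLine z w p).natDegree ≤ p.totalDegree := by
  have := MvPolynomial.aeval_natDegree_le p le_rfl (fun i => C (z i) + C (w i) * X)
    (n := 1) (fun i => by compute_degree)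
  exact this.trans_eq (mul_one _)

/-- At an integer point where `f` is nonzero, `|f| ≥ 1`, so `norm_root_pow_le` bounds the
coefficients there. Along a line the bound grows more slowly than any nonconstant polynomial, so the
coefficients are constants, bounded by the estimate at one base point `z`. -/
theorem exists_finite_charpoly_of_int {E : Type*} [Field E] [Algebra (MvPolynomial σ ℤ) E]
    [IsFractionRing (MvPolynomial σ ℤ) E] {f : MvPolynomial σ ℤ} (hf : f ≠ 0)
    {s : Set (Matrix n n (MvPolynomial σ ℤ))} (hs : s.Finite) :
    ∃ N : ℕ, 0 < N ∧ ∃ 𝓛 : Set E[X], 𝓛.Finite ∧ ∀ a : Matrix n n E,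
      SlowPowers f s N a → a.charpoly ∈ 𝓛 := by
  let P := MvPolynomial σ ℤ
  set d := Fintype.card n
  have hPE : Function.Injective (algebraMap P E) := IsFractionRing.injective P E
  obtain ⟨N₀, hN₀, hfN⟩ := exists_isUnit_of_pow_dvd (pow_ne_zero d hf)
  obtain ⟨e, he⟩ := exists_totalDegree_le hs
  obtain ⟨z, hz⟩ : ∃ z : σ → ℤ, MvPolynomial.eval z f ≠ 0 := by
    by_contra! h
    exact hf (MvPolynomial.funext fun z => by simpa using h z)
  -- `N₀` serves integrality; `e * d < N` makes the growth along lines sublinear after taking `N`-th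
  -- roots.
  let N := N₀ + e * d + 1
  let T : (σ → ℤ) → ℝ := fun v =>
    1 + ∑ x ∈ hs.toFinset, ∑ i, ∑ j, |((MvPolynomial.eval v (x i j) : ℤ) : ℝ)|
  have hT1 : ∀ v, 1 ≤ T v := fun v => le_add_of_nonneg_right
    (Finset.sum_nonneg fun _ _ => Finset.sum_nonneg fun _ _ => Finset.sum_nonneg fun _ _ =>
      abs_nonneg _)
  let c := (d.choose (d / 2) : ℝ)
  have hcoeff : ∀ a : Matrix n n E, SlowPowers f s N a → ∃ q : P[X],
      q.map (algebraMap P E) = a.charpoly ∧ ∀ v : σ → ℤ, MvPolynomial.eval v f ≠ 0 → ∀ i,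
        |((MvPolynomial.eval v (q.coeff i) : ℤ) : ℝ)| ^ N ≤ T v ^ d * c ^ N := by
    intro a ha
    obtain ⟨m₀, hm₀⟩ := Filter.eventually_atTop.1 ha
    obtain ⟨l, hl, hlN, hlp⟩ := hm₀ (m₀ + 1) (by omega)
    obtain ⟨q, hq⟩ := exists_map_eq_charpoly hf hN₀ (hfN N₀ le_rfl) (Nat.succ_pos m₀)
      (le_trans (Nat.mul_le_mul_right _ (by omega)) hlN) hlp
    have hqm : q.Monic := (Function.Injective.monic_map_iff hPE).2 (hq ▸ Matrix.charpoly_monic a)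
    have hqd : q.natDegree = d := by
      rw [← natDegree_map_eq_of_injective hPE, hq, Matrix.charpoly_natDegree_eq_dim]
    refine ⟨q, hq, fun v hv i => ?_⟩
    let θ : P →+* ℂ := (Int.castRingHom ℂ).comp (MvPolynomial.eval v)
    have hθ : ∀ p, ‖θ p‖ = |((MvPolynomial.eval v p : ℤ) : ℝ)| := fun p => by simp [θ]
    have hθf : 1 ≤ ‖θ f‖ := by
      rw [hθ]
      exact_mod_cast Int.one_le_abs hv
    have hroot : ∀ μ ∈ (q.map θ).roots, ‖μ‖ ≤ T v ^ ((N : ℝ)⁻¹) := by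
      intro μ hμ
      have h1 := norm_root_pow_le hPE θ hθf (hT1 v) (fun x hx => ?_) (Nat.succ_pos m₀) hl hlN
        hlp hq (isRoot_of_mem_roots hμ)
      · rw [Real.le_rpow_inv_iff_of_pos (norm_nonneg _) (by linarith [hT1 v]) (by positivity)]
        exact_mod_cast h1
      · simp only [hθ]
        refine le_add_of_nonneg_of_le zero_le_one ?_
        exact Finset.single_le_sum (f := fun x : Matrix n n P =>
          ∑ i, ∑ j, |((MvPolynomial.eval v (x i j) : ℤ) : ℝ)|)
          (fun _ _ => Finset.sum_nonneg fun _ _ => Finset.sum_nonneg fun _ _ => abs_nonneg _)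
          (hs.mem_toFinset.2 hx)
    have h2 := coeff_bdd_of_roots_le (RingHom.id ℂ) (hqm.map θ) (IsAlgClosed.splits _)
      (d := d) ((hqm.natDegree_map θ).trans hqd).le (by simpa using hroot) i
    rw [max_eq_left (Real.one_le_rpow (hT1 v) (by positivity)), Polynomial.map_id, coeff_map,
      hθ] at h2
    refine (pow_le_pow_left₀ (abs_nonneg _) h2 N).trans_eq ?_
    rw [mul_pow, ← pow_mul, mul_comm d N, pow_mul, Real.rpow_inv_natCast_pow
      (by linarith [hT1 v]) (by omega)]
  have hTline : ∀ w : σ → ℤ, ∃ K : ℝ, 0 ≤ K ∧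
      ∀ t : ℕ, T (fun i => z i + w i * t) ≤ K * (1 + t) ^ e := by
    intro w
    let κ : P → ℝ := fun p => ∑ i ∈ Finset.range (e + 1), |((toLine z w p).coeff i : ℝ)|
    have hκ : ∀ p, 0 ≤ κ p := fun p => Finset.sum_nonneg fun _ _ => abs_nonneg _
    refine ⟨1 + ∑ x ∈ hs.toFinset, ∑ i, ∑ j, κ (x i j), add_nonneg zero_le_one
      (Finset.sum_nonneg fun _ _ => Finset.sum_nonneg fun _ _ => Finset.sum_nonneg fun _ _ =>
        hκ _), fun t => ?_⟩
    rw [add_mul, one_mul, Finset.sum_mul]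
    have ht : (1 : ℝ) ≤ 1 + t := le_add_of_nonneg_right (Nat.cast_nonneg t)
    refine add_le_add (one_le_pow₀ ht) (Finset.sum_le_sum fun x hx => ?_)
    rw [Finset.sum_mul]
    refine Finset.sum_le_sum fun i _ => ?_
    rw [Finset.sum_mul]
    refine Finset.sum_le_sum fun j _ => ?_
    rw [← eval_toLine]
    exact abs_eval_natCast_le _ ((natDegree_toLine_le z w _).trans
      (he x (hs.mem_toFinset.1 hx) i j)) t
  refine ⟨N, by omega, {q | q.natDegree ≤ d ∧ ∀ i, q.coeff i ∈
      (fun r : ℤ => algebraMap P E (MvPolynomial.C r)) '' {r | |(r : ℝ)| ^ N ≤ T z ^ d * c ^ N}},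
    finite_setOf_coeff_mem _ (Set.Finite.image _ ?_), fun a ha => ⟨?_, fun i => ?_⟩⟩
  · obtain ⟨M, hM⟩ := exists_nat_ge (T z ^ d * c ^ N)
    refine (Set.finite_Icc (-(M : ℤ)) M).subset fun r hr => ?_
    have h1 : |r| ≤ M := by
      rcases eq_or_ne r 0 with rfl | h0
      · simp
      have h2 : (1 : ℝ) ≤ |(r : ℝ)| := by exact_mod_cast Int.one_le_abs h0
      have h3 : |(r : ℝ)| ≤ M := (le_self_pow₀ h2 (by omega)).trans (le_trans hr hM)
      exact_mod_cast h3
    exact abs_le.1 h1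
  · rw [Matrix.charpoly_natDegree_eq_dim]
  obtain ⟨q, hq, hqc⟩ := hcoeff a ha
  -- Every integer point lies on such a line through `z`, and `f` vanishes at only finitely many
  -- parameters because `f` is nonzero at `z`.
  have hconst : ∀ w : σ → ℤ, MvPolynomial.eval (fun i => z i + w i) (q.coeff i) =
      MvPolynomial.eval z (q.coeff i) := by
    intro w
    obtain ⟨K, hK0, hK⟩ := hTline w
    have h0 : (toLine z w (q.coeff i)).natDegree = 0 := by
      apply natDegree_eq_zero_of_pow_le _ (e := e * d) (N := N) (by omega) (K ^ d * c ^ N)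
      have hf0 : (toLine z w f) ≠ 0 := by
        intro h
        have := eval_toLine z w 0 f
        simp [h] at this
        exact hz this.symm
      have hev : ∀ᶠ t : ℕ in Filter.atTop, (toLine z w f).eval (t : ℤ) ≠ 0 := by
        have := (finite_setOfPred_isRoot hf0).preimage (Nat.cast_injective (R := ℤ)).injOn
        exact Nat.cofinite_eq_atTop ▸ this.eventually_cofinite_notMem
      filter_upwards [hev] with t ht
      rw [eval_toLine] at ht ⊢
      refine (hqc _ ht i).trans ?_
      rw [pow_mul, mul_right_comm, ← mul_pow]
      have := hT1 (fun i => z i + w i * t)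
      gcongr
      exact hK t
    rw [natDegree_eq_zero] at h0
    obtain ⟨r, hr⟩ := h0
    have h1 := eval_toLine z w 0 (q.coeff i)
    have h2 := eval_toLine z w 1 (q.coeff i)
    rw [← hr, eval_C] at h1 h2
    simpa using h2.symm.trans h1
  have hC : q.coeff i = MvPolynomial.C (MvPolynomial.eval z (q.coeff i)) := by
    apply MvPolynomial.funext
    intro v
    have := hconst (fun i => v i - z i)
    simpa using this
  refine ⟨_, hqc z hz i, ?_⟩
  rw [← hq, coeff_map]
  exact congrArg _ hC.symm

end CharZero

end NIU

namespace NIU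

open Polynomial

/-! ### From equal characteristic polynomials to unipotent powers. -/

section Torsion

/-- In a finite set `s` of nonzero elements with `{x ^ i} ⊇ {x ^ j}`, `0 < i < j`, every element
is a root of unity. -/
theorem exists_pow_eq_one_of_forall_exists_pow_eq {K : Type*} [Field K] {s : Set K}
    (hs : s.Finite) (h0 : (0 : K) ∉ s) {i j : ℕ} (hi : 0 < i) (hij : i < j)
    (h : ∀ x ∈ s, ∃ y ∈ s, y ^ i = x ^ j) {x : K} (hx : x ∈ s) : ∃ k, 0 < k ∧ x ^ k = 1 := by
  -- An orbit of `φ` in the finite set repeats; comparing the two visits gives two different powers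
  -- of `x` that agree.
  choose! φ hφ hφp using h
  have hmem : ∀ u, φ^[u] x ∈ s := fun u => by
    induction u with
    | zero => exact hx
    | succ u ih => rw [Function.iterate_succ_apply']; exact hφ _ ih
  have hpow : ∀ u, (φ^[u] x) ^ i ^ u = x ^ j ^ u := fun u => by
    induction u with
    | zero => simp
    | succ u ih =>
      rw [Function.iterate_succ_apply', pow_succ', pow_mul, hφp _ (hmem u), ← pow_mul,
        mul_comm j, pow_mul, ih, ← pow_mul, pow_succ]
  obtain ⟨u, v, huv, he⟩ := Set.Finite.exists_lt_map_eq_of_forall_mem (f := fun u => φ^[u] x)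
    hmem hs
  have h1 : x ^ (j ^ v * i ^ u) = x ^ (j ^ u * i ^ v) := by
    rw [pow_mul, pow_mul, ← hpow, ← hpow, ← he, ← pow_mul, ← pow_mul, mul_comm]
  have hlt : j ^ u * i ^ v < j ^ v * i ^ u := by
    obtain ⟨t, rfl⟩ := Nat.exists_eq_add_of_lt huv
    have h2 : i ^ (t + 1) < j ^ (t + 1) := Nat.pow_lt_pow_left hij (by omega)
    have h3 : 0 < j ^ u * i ^ u := Nat.mul_pos (pow_pos (by omega) _) (pow_pos hi _)
    calc j ^ u * i ^ (u + t + 1) = j ^ u * i ^ u * i ^ (t + 1) := by ring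
      _ < j ^ u * i ^ u * j ^ (t + 1) := by gcongr
      _ = _ := by ring
  have hx0 : x ≠ 0 := by rintro rfl; exact h0 hx
  refine ⟨j ^ v * i ^ u - j ^ u * i ^ v, by omega, ?_⟩
  rw [pow_sub₀ _ hx0 hlt.le, h1, mul_inv_cancel₀ (pow_ne_zero _ hx0)]

variable {E : Type*} [Field E] {n : Type*} [Fintype n] [DecidableEq n]

theorem isNilpotent_sub_one_of_spectrum_subset [IsAlgClosed E] (b : Matrix n n E)
    (h : spectrum E b ⊆ {1}) : IsNilpotent (b - 1) := by
  have h1 : b.charpoly = (X - C 1) ^ Multiset.card b.charpoly.roots := by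
    have h2 : b.charpoly.roots = Multiset.replicate (Multiset.card b.charpoly.roots) 1 :=
      Multiset.eq_replicate_card.2 fun μ hμ =>
        h (Matrix.mem_spectrum_of_isRoot_charpoly (isRoot_of_mem_roots hμ))
    have h3 := (IsAlgClosed.splits b.charpoly).eq_prod_roots_of_monic (Matrix.charpoly_monic b)
    rw [h2] at h3
    simpa using h3
  refine ⟨Multiset.card b.charpoly.roots, ?_⟩
  have h4 := Matrix.aeval_self_charpoly b
  rw [h1] at h4
  simpa using h4

/-- If two distinct positive powers of an invertible matrix have the same characteristic
polynomial, then some positive power of it is unipotent. -/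
theorem exists_isNilpotent_pow_sub_one {a : Matrix n n E} (ha : IsUnit a) {i j : ℕ} (hi : 0 < i)
    (hij : i < j) (h : (a ^ i).charpoly = (a ^ j).charpoly) :
    ∃ k, 0 < k ∧ IsNilpotent (a ^ k - 1) := by
  let K := AlgebraicClosure E
  let b := (algebraMap E K).mapMatrix a
  have hb : IsUnit b := ha.map _
  have hchar : (b ^ i).charpoly = (b ^ j).charpoly := by
    rw [← map_pow, ← map_pow, RingHom.mapMatrix_apply, RingHom.mapMatrix_apply,
      Matrix.charpoly_map, Matrix.charpoly_map, h]
  have hspec : spectrum K (b ^ i) = spectrum K (b ^ j) := by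
    ext μ
    rw [Matrix.mem_spectrum_iff_isRoot_charpoly, Matrix.mem_spectrum_iff_isRoot_charpoly, hchar]
  rw [spectrum.map_pow_of_pos b hi, spectrum.map_pow_of_pos b (hi.trans hij)] at hspec
  have hfin : (spectrum K b).Finite := Matrix.finite_spectrum b
  have hroot : ∀ μ ∈ spectrum K b, ∃ k, 0 < k ∧ μ ^ k = 1 := fun μ hμ =>
    exists_pow_eq_one_of_forall_exists_pow_eq hfin (spectrum.zero_notMem K hb) hi hij
      (fun x hx => by
        have : x ^ j ∈ (· ^ i) '' spectrum K b := hspec ▸ ⟨x, hx, rfl⟩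
        exact this) hμ
  choose! k hk0 hk using hroot
  have hpos : 0 < ∏ μ ∈ hfin.toFinset, k μ :=
    Finset.prod_pos fun μ hμ => hk0 μ (hfin.mem_toFinset.1 hμ)
  refine ⟨∏ μ ∈ hfin.toFinset, k μ, hpos, ?_⟩
  have h1 : IsNilpotent (b ^ (∏ μ ∈ hfin.toFinset, k μ) - 1) := by
    apply isNilpotent_sub_one_of_spectrum_subset
    rw [spectrum.map_pow_of_pos b hpos]
    rintro _ ⟨μ, hμ, rfl⟩
    obtain ⟨c, hc⟩ := Finset.dvd_prod_of_mem k (hfin.mem_toFinset.2 hμ)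
    simp only [Set.mem_singleton_iff]
    rw [hc, pow_mul, hk μ hμ, one_pow]
  rw [← map_pow, ← map_one ((algebraMap E K).mapMatrix : Matrix n n E →+* _), ← map_sub] at h1
  exact (IsNilpotent.map_iff (Matrix.map_injective (algebraMap E K).injective)).1 h1

end Torsion

/-! ### Word length. -/

section WordLength

variable {G : Type*} [Group G] {S : Set G}

theorem wordLength_prod_le (l : List G) (hl : ∀ x ∈ l, x ∈ S ∨ x⁻¹ ∈ S) :
    wordLength S l.prod ≤ l.length :=
  Nat.sInf_le ⟨l, hl, rfl, rfl⟩

theorem wordLength_one : wordLength S (1 : G) = 0 :=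
  Nat.le_zero.1 (wordLength_prod_le (S := S) [] (by simp))

theorem wordLength_mul_le (hS : Subgroup.closure S = ⊤) (g h : G) :
    wordLength S (g * h) ≤ wordLength S g + wordLength S h := by
  obtain ⟨l, hl, hlp, hll⟩ := exists_list_length_eq_wordLength hS g
  obtain ⟨r, hr, hrp, hrl⟩ := exists_list_length_eq_wordLength hS h
  rw [← hll, ← hrl, ← List.length_append, ← hlp, ← hrp, ← List.prod_append]
  exact wordLength_prod_le _ fun x hx => (List.mem_append.1 hx).elim (hl x) (hr x)

theorem wordLength_inv_le (hS : Subgroup.closure S = ⊤) (g : G) :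
    wordLength S g⁻¹ ≤ wordLength S g := by
  obtain ⟨l, hl, hlp, hll⟩ := exists_list_length_eq_wordLength hS g
  rw [← hll, ← hlp, List.prod_inv_reverse]
  refine (wordLength_prod_le _ ?_).trans_eq (by simp)
  intro x hx
  simp only [List.mem_reverse, List.mem_map] at hx
  obtain ⟨y, hy, rfl⟩ := hx
  rw [inv_inv]
  exact (hl y hy).symm

theorem wordLength_pow_le (hS : Subgroup.closure S = ⊤) (g : G) (m : ℕ) :
    wordLength S (g ^ m) ≤ m * wordLength S g := by
  induction m with
  | zero => simp [wordLength_one]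
  | succ m ih =>
    rw [pow_succ]
    have := wordLength_mul_le hS (g ^ m) g
    linarith

theorem eq_one_of_wordLength_eq_zero (hS : Subgroup.closure S = ⊤) {g : G}
    (hg : wordLength S g = 0) : g = 1 := by
  obtain ⟨l, -, hlp, hll⟩ := exists_list_length_eq_wordLength hS g
  rw [hg, List.length_eq_zero_iff] at hll
  simpa [hll] using hlp.symm

/-- A linear upper bound for the word length of one power of `g` propagates to large powers. -/
theorem eventually_mul_wordLength_pow_le (hS : Subgroup.closure S = ⊤) (g : G) {N m₁ : ℕ}
    (h : N * wordLength S (g ^ m₁) < m₁) :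
    ∀ᶠ m in Filter.atTop, N * wordLength S (g ^ m) ≤ m := by
  -- Past this threshold the remainder modulo `m₁` costs at most `m / m₁`, which the strict
  -- inequality in `h` absorbs, one unit per block.
  filter_upwards [Filter.eventually_ge_atTop (m₁ * (N * (m₁ * wordLength S g)))] with m hm
  have h1 : wordLength S (g ^ m) ≤
      (m / m₁) * wordLength S (g ^ m₁) + (m % m₁) * wordLength S g := by
    conv_lhs => rw [← Nat.div_add_mod m m₁, pow_add, pow_mul]
    exact (wordLength_mul_le hS _ _).trans
      (add_le_add (wordLength_pow_le hS _ _) (wordLength_pow_le hS _ _))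
  have hm₁ : 0 < m₁ := by omega
  have h2 : m % m₁ ≤ m₁ := (Nat.mod_lt _ hm₁).le
  have h3 : N * (m₁ * wordLength S g) ≤ m / m₁ := (Nat.le_div_iff_mul_le hm₁).2 (by linarith)
  have h4 := Nat.div_add_mod m m₁
  calc N * wordLength S (g ^ m)
      ≤ N * ((m / m₁) * wordLength S (g ^ m₁) + m₁ * wordLength S g) := by
        gcongr
        exact h1.trans (by gcongr)
    _ = (m / m₁) * (N * wordLength S (g ^ m₁)) + N * (m₁ * wordLength S g) := by ring
    _ ≤ (m / m₁) * (N * wordLength S (g ^ m₁)) + m / m₁ := by gcongr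
    _ = (m / m₁) * (N * wordLength S (g ^ m₁) + 1) := by ring
    _ ≤ (m / m₁) * m₁ := by gcongr; omega
    _ ≤ m := Nat.div_mul_le_self m m₁

end WordLength

/-! ### Uniform lower bound for translation lengths. -/

section Translation

variable {P E : Type*} [CommRing P] [IsDomain P] [Field E] [Algebra P E] [IsFractionRing P E]
  {n : Type*} [Fintype n] [DecidableEq n] {G : Type*} [Group G]

theorem exists_common_denominator (ρ : G →* Matrix n n E) {S : Set G} (hS : S.Finite) :
    ∃ f : P, f ≠ 0 ∧ ∀ s, s ∈ S ∨ s⁻¹ ∈ S →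
      ∃ B : Matrix n n P, algebraMap P E f • ρ s = B.map (algebraMap P E) := by
  have hfin : {s | s ∈ S ∨ s⁻¹ ∈ S}.Finite := hS.union hS.inv
  have : Finite {s | s ∈ S ∨ s⁻¹ ∈ S} := hfin
  obtain ⟨f, hf⟩ := IsLocalization.exist_integer_multiples_of_finite (nonZeroDivisors P)
    (fun x : {s | s ∈ S ∨ s⁻¹ ∈ S} × n × n => ρ x.1 x.2.1 x.2.2)
  refine ⟨f, nonZeroDivisors.ne_zero f.2, fun s hs => ?_⟩
  choose r hr using hf
  refine ⟨Matrix.of fun i j => r (⟨s, hs⟩, i, j), ?_⟩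
  ext i j
  simp [hr, Algebra.smul_def]

/-- Elements of infinite order have translation length bounded below. -/
theorem exists_le_mul_wordLength_pow (ρ : G →* Matrix n n E)
    (hρ : ∀ g, IsNilpotent (ρ g - 1) → IsOfFinOrder g)
    (key : ∀ f : P, f ≠ 0 → ∀ s : Set (Matrix n n P), s.Finite →
      ∃ N : ℕ, 0 < N ∧ ∃ 𝓛 : Set E[X], 𝓛.Finite ∧ ∀ a : Matrix n n E,
        SlowPowers f s N a → a.charpoly ∈ 𝓛)
    {S : Set G} (hSf : S.Finite) (hS : Subgroup.closure S = ⊤) :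
    ∃ N : ℕ, 0 < N ∧ ∀ g, ¬ IsOfFinOrder g → ∀ m, m ≤ N * wordLength S (g ^ m) := by
  obtain ⟨f, hf, hB⟩ := exists_common_denominator (P := P) ρ hSf
  choose! B hB using hB
  obtain ⟨N, hN, 𝓛, h𝓛, hkey⟩ := key f hf (B '' {s | s ∈ S ∨ s⁻¹ ∈ S})
    ((hSf.union hSf.inv).image B)
  -- One more power than there are polynomials. The extra factor `J` in the constant makes `g ^ j`
  -- slow for every `j ≤ J`.
  let J := h𝓛.toFinset.card + 1
  refine ⟨N * J, Nat.mul_pos hN (Nat.succ_pos _), fun g hg m₁ => ?_⟩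
  by_contra! hlt
  apply hg
  have hev := eventually_mul_wordLength_pow_le hS g hlt
  have hslow : ∀ j, 0 < j → j ≤ J → (ρ g ^ j).charpoly ∈ 𝓛 := by
    intro j hj hjJ
    apply hkey
    have ht : Filter.Tendsto (fun m => j * m) Filter.atTop Filter.atTop :=
      Filter.tendsto_id.const_mul_atTop' hj
    filter_upwards [ht.eventually hev] with m hm
    obtain ⟨l, hl, hlp, hll⟩ := exists_list_length_eq_wordLength hS (g ^ (j * m))
    refine ⟨l.map B, ?_, ?_, ?_⟩
    · intro x hx
      obtain ⟨y, hy, rfl⟩ := List.mem_map.1 hx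
      exact ⟨y, hl y hy, rfl⟩
    · rw [List.length_map, hll]
      have : J * (N * wordLength S (g ^ (j * m))) ≤ J * m := by
        calc _ = N * J * wordLength S (g ^ (j * m)) := by ring
          _ ≤ j * m := hm
          _ ≤ J * m := by gcongr
      exact Nat.le_of_mul_le_mul_left this (Nat.succ_pos _)
    · rw [← pow_mul, ← map_pow ρ, ← hlp, List.length_map]
      clear hlp hll
      induction l with
      | nil => simp
      | cons x l ih =>
        have h1 := hB x (hl x (by simp))
        have h2 := ih fun y hy => hl y (by simp [hy])
        simp only [List.map_cons, List.prod_cons, List.length_cons]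
        rw [Matrix.map_mul, ← h1, ← h2, map_mul, pow_succ', smul_mul_smul_comm]
  obtain ⟨i, hi, j, hj, hij, he⟩ := Finset.exists_ne_map_eq_of_card_lt_of_maps_to
    (s := Finset.Icc 1 J) (t := h𝓛.toFinset) (f := fun j => (ρ g ^ j).charpoly) (by simp [J])
    (fun j hj => by
      have := Finset.mem_Icc.1 hj
      exact h𝓛.mem_toFinset.2 (hslow j (by omega) this.2))
  have hu : IsUnit (ρ g) := (Group.isUnit g).map ρ
  have hk : ∃ k, 0 < k ∧ IsNilpotent (ρ g ^ k - 1) := by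
    have hi' := (Finset.mem_Icc.1 hi).1
    have hj' := (Finset.mem_Icc.1 hj).1
    rcases lt_or_gt_of_ne hij with h | h
    · exact exists_isNilpotent_pow_sub_one hu (by omega) h he
    · exact exists_isNilpotent_pow_sub_one hu (by omega) h he.symm
  obtain ⟨k, hk0, hk⟩ := hk
  rw [← map_pow] at hk
  exact (hρ _ hk).of_pow hk0.ne'

end Translation

end NIU

namespace NIU

/-! ### Lengths on lattices and on finitely generated abelian groups. -/

section Lattice

variable {J : Type*} [Fintype J] [DecidableEq J] {ℓ : (J → ℤ) → ℕ}

theorem apply_le_mul_sum_single (h0 : ℓ 0 = 0) (hadd : ∀ x y, ℓ (x + y) ≤ ℓ x + ℓ y)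
    (hneg : ∀ x, ℓ (-x) ≤ ℓ x) (x : J → ℤ) {M : ℕ} (hM : ∀ i, (x i).natAbs ≤ M) :
    ℓ x ≤ M * ∑ i, ℓ (Pi.single i 1) := by
  have hnsmul : ∀ (m : ℕ) y, ℓ (m • y) ≤ m * ℓ y := fun m y => by
    induction m with
    | zero => simp [h0]
    | succ m ih =>
      rw [succ_nsmul]
      have := hadd (m • y) y
      linarith
  have hzsmul : ∀ (m : ℤ) y, ℓ (m • y) ≤ m.natAbs * ℓ y := fun m y => by
    rcases Int.natAbs_eq m with h | h
    · conv_lhs => rw [h, natCast_zsmul]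
      exact hnsmul _ _
    · conv_lhs => rw [h, neg_smul, natCast_zsmul]
      exact (hneg _).trans (hnsmul _ _)
  have hsum : ∀ s : Finset J, ℓ (∑ i ∈ s, x i • Pi.single i 1) ≤
      ∑ i ∈ s, M * ℓ (Pi.single i 1) := fun s => by
    induction s using Finset.induction_on with
    | empty => simp [h0]
    | insert a s ha ih =>
      rw [Finset.sum_insert ha, Finset.sum_insert ha]
      refine (hadd _ _).trans (add_le_add ((hzsmul _ _).trans ?_) ih)
      gcongr
      exact hM a
  have hx : x = ∑ i, x i • Pi.single i (1 : ℤ) := by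
    simpa [← Pi.single_smul'] using (Finset.univ_sum_single x).symm
  rw [Finset.mul_sum]
  conv_lhs => rw [hx]
  exact hsum _

/-- Simultaneous Diophantine approximation, in integral form. -/
theorem exists_simultaneous_approx (x : J → ℤ) {X : ℕ} (hX : 0 < X) {Q : ℕ} (hQ : 0 < Q) :
    ∃ q : ℕ, 0 < q ∧ q ≤ Q ^ Fintype.card J ∧ ∃ p e : J → ℤ,
      (∀ i, q * x i = X * p i + e i) ∧ (∀ i, (e i).natAbs ≤ X / Q) ∧
      ∀ i, (X : ℤ) ∣ x i → e i = 0 := by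
  have hXz : (0 : ℤ) < X := by exact_mod_cast hX
  have hQz : (0 : ℤ) < Q := by exact_mod_cast hQ
  -- Dirichlet's box argument: `Q ^ |J| + 1` multiples of `x` modulo `X` fall into `Q ^ |J|` boxes
  -- of side `X / Q`.
  let cell : ℕ → J → ℤ := fun q i => ((q * x i) % X) * Q / X
  obtain ⟨a, ha, b, hb, hab, he⟩ := Finset.exists_ne_map_eq_of_card_lt_of_maps_to
    (s := Finset.range (Q ^ Fintype.card J + 1))
    (t := Fintype.piFinset fun _ : J => Finset.Ico (0 : ℤ) Q) (f := cell) (by simp)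
    (fun q _ => by
      rw [Finset.mem_coe, Fintype.mem_piFinset]
      intro i
      have h1 := Int.emod_nonneg (q * x i) hXz.ne'
      have h2 := Int.emod_lt_of_pos (q * x i) hXz
      rw [Finset.mem_Ico]
      refine ⟨by positivity, Int.ediv_lt_of_lt_mul hXz ?_⟩
      nlinarith)
  wlog hlt : a < b generalizing a b
  · exact this b hb a ha hab.symm he.symm (by omega)
  rw [Finset.mem_range] at ha hb
  refine ⟨b - a, by omega, by omega, fun i => b * x i / X - a * x i / X,
    fun i => (b * x i) % X - (a * x i) % X, fun i => ?_, fun i => ?_, fun i hi => ?_⟩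
  · have h1 := Int.emod_add_mul_ediv (b * x i) X
    have h2 := Int.emod_add_mul_ediv (a * x i) X
    rw [Nat.cast_sub hlt.le]
    linear_combination h2 - h1
  · have h := congrFun he i
    simp only [cell] at h
    have h1 := Int.emod_add_mul_ediv (b * x i % X * Q) X
    have h2 := Int.emod_add_mul_ediv (a * x i % X * Q) X
    have h3 := Int.emod_nonneg (b * x i % X * Q) hXz.ne'
    have h4 := Int.emod_lt_of_pos (b * x i % X * Q) hXz
    have h5 := Int.emod_nonneg (a * x i % X * Q) hXz.ne'
    have h6 := Int.emod_lt_of_pos (a * x i % X * Q) hXz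
    rw [h] at h2
    rw [Nat.le_div_iff_mul_le hQ]
    zify
    rw [← abs_of_pos hQz, ← abs_mul, abs_le]
    constructor <;> nlinarith
  · beta_reduce
    rw [Int.emod_eq_zero_of_dvd (hi.mul_left _), Int.emod_eq_zero_of_dvd (hi.mul_left _), sub_self]

/-- A length function on a lattice whose translation lengths are bounded below dominates the
supremum norm. -/
theorem exists_natAbs_le_mul (h0 : ℓ 0 = 0) (hadd : ∀ x y, ℓ (x + y) ≤ ℓ x + ℓ y)
    (hneg : ∀ x, ℓ (-x) ≤ ℓ x) {N : ℕ} (hN : ∀ x, x ≠ 0 → ∀ m : ℕ, m ≤ N * ℓ (m • x)) :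
    ∃ C : ℕ, ∀ x i, (x i).natAbs ≤ C * ℓ x := by
  let c := ∑ i, ℓ (Pi.single i 1)
  -- Chosen so that the error vector contributes at most `X / 2` to the bound on `X`.
  let Q := 2 * (N * c) + 1
  refine ⟨2 * (N * Q ^ Fintype.card J), fun x i => ?_⟩
  obtain ⟨j, -, hj⟩ := Finset.exists_max_image Finset.univ (fun i => (x i).natAbs) ⟨i, by simp⟩
  let X := (x j).natAbs
  refine (hj i (by simp)).trans (?_ : X ≤ _)
  rcases Nat.eq_zero_or_pos X with hX | hX
  · omega
  obtain ⟨q, hq0, hq, p, e, hpe, he, he0⟩ := exists_simultaneous_approx x hX (Q := Q) (by omega)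
  -- In the coordinate `j` of largest size the approximation is exact, since `X` divides `x j`.
  have hp : p ≠ 0 := by
    rintro rfl
    have h1 := hpe j
    rw [he0 j (Int.natAbs_dvd.2 dvd_rfl)] at h1
    have h2 : x j ≠ 0 := Int.natAbs_pos.1 hX
    simp [h2] at h1
    omega
  have h1 : X • p = q • x + -e := by
    ext i
    have := hpe i
    change X • p i = q • x i + -e i
    rw [nsmul_eq_mul, nsmul_eq_mul]
    linarith
  have hsmul : ∀ m : ℕ, ℓ (m • x) ≤ m * ℓ x := fun m => by
    induction m with
    | zero => simp [h0]
    | succ m ih =>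
      rw [succ_nsmul]
      have := hadd (m • x) x
      linarith
  have h2 := hN p hp X
  have h3 : ℓ (-e) ≤ X / Q * c :=
    (hneg e).trans (apply_le_mul_sum_single h0 hadd hneg e he)
  have h4 : 2 * (N * c) * (X / Q) ≤ X :=
    (Nat.mul_le_mul_right _ (by omega)).trans (Nat.mul_div_le X Q)
  have h5 : ℓ (X • p) ≤ q * ℓ x + X / Q * c := by
    rw [h1]
    exact (hadd _ _).trans (add_le_add (hsmul q) h3)
  have h6 : N * ℓ (X • p) ≤ N * (q * ℓ x + X / Q * c) := by gcongr
  have h7 : N * (q * ℓ x) ≤ N * (Q ^ Fintype.card J * ℓ x) := by gcongr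
  have h8 : N * (q * ℓ x + X / Q * c) = N * (q * ℓ x) + (N * c) * (X / Q) := by ring
  have h9 : 2 * (N * Q ^ Fintype.card J) * ℓ x = 2 * (N * (Q ^ Fintype.card J * ℓ x)) := by ring
  have h10 : 2 * (N * c) * (X / Q) = 2 * ((N * c) * (X / Q)) := by ring
  omega

end Lattice

/-- In a finitely generated commutative group, a length function whose translation lengths are
bounded below on elements of infinite order dominates the word length. -/
theorem exists_wordLength_le_mul {A : Type*} [CommGroup A] {T : Set A} (hTf : T.Finite)
    (hT : Subgroup.closure T = ⊤) {ℓ : A → ℕ} (h1 : ∀ a, ℓ a = 0 ↔ a = 1)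
    (hmul : ∀ a b, ℓ (a * b) ≤ ℓ a + ℓ b) (hinv : ∀ a, ℓ a⁻¹ ≤ ℓ a) {N : ℕ}
    (hN : ∀ a, ¬ IsOfFinOrder a → ∀ m : ℕ, m ≤ N * ℓ (a ^ m)) :
    ∃ C : ℕ, ∀ a, wordLength T a ≤ C * ℓ a := by
  classical
  have : Group.FG A := Group.fg_iff.2 ⟨T, hT, hTf⟩
  obtain ⟨ι, J, _, _, p, hp, k, ⟨e⟩⟩ := CommGroup.equiv_free_prod_prod_multiplicative_zmod A
  have : ∀ i, NeZero (p i ^ k i) := fun i => ⟨pow_ne_zero _ (hp i).ne_zero⟩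
  let Φ := (i : ι) → Multiplicative (ZMod (p i ^ k i))
  have : ∀ i, Finite (Multiplicative (ZMod (p i ^ k i))) := fun i =>
    inferInstanceAs (Finite (ZMod (p i ^ k i)))
  have : Finite Φ := Pi.finite
  have := Fintype.ofFinite Φ
  let φ : (J → ℤ) → A := fun x => e.symm (fun i => Multiplicative.ofAdd (x i), 1)
  let ψ : Φ → A := fun b => e.symm (1, b)
  have hφ0 : φ 0 = 1 := e.symm.map_one
  have hφadd : ∀ x y, φ (x + y) = φ x * φ y := fun x y => by
    change e.symm _ = e.symm _ * e.symm _
    rw [← e.symm.map_mul, Prod.mk_mul_mk, mul_one]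
    rfl
  have hφneg : ∀ x, φ (-x) = (φ x)⁻¹ := fun x => by
    rw [eq_inv_iff_mul_eq_one, ← hφadd, neg_add_cancel, hφ0]
  have hφsmul : ∀ (m : ℕ) x, φ (m • x) = φ x ^ m := fun m x => by
    induction m with
    | zero => simp [hφ0]
    | succ m ih => rw [succ_nsmul, hφadd, ih, pow_succ]
  have hφinj : ∀ x, φ x = 1 → x = 0 := fun x hx => by
    have h := (map_eq_one_iff e.symm e.symm.injective).1 hx
    ext i
    have := congrFun (congrArg Prod.fst h) i
    exact Multiplicative.ofAdd.injective this
  have hφord : ∀ x, x ≠ 0 → ¬ IsOfFinOrder (φ x) := fun x hx h => by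
    obtain ⟨m, hm, hm1⟩ := isOfFinOrder_iff_pow_eq_one.1 h
    rw [← hφsmul] at hm1
    exact hx ((smul_eq_zero.1 (hφinj _ hm1)).resolve_left hm.ne')
  have hdec : ∀ a, ∃ x b, a = φ x * ψ b := fun a => by
    refine ⟨fun i => Multiplicative.toAdd ((e a).1 i), (e a).2, ?_⟩
    rw [← e.symm.map_mul, Prod.mk_mul_mk, mul_one, one_mul]
    exact (e.symm_apply_apply a).symm
  obtain ⟨C, hC⟩ := exists_natAbs_le_mul (ℓ := fun x => ℓ (φ x)) (by simp [hφ0, h1])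
    (fun x y => by rw [hφadd]; exact hmul _ _) (fun x => by rw [hφneg]; exact hinv _)
    (fun x hx m => by rw [hφsmul]; exact hN _ (hφord x hx) m)
  let c := ∑ i, wordLength T (φ (Pi.single i 1))
  let M := ∑ b, ℓ (ψ b)
  let M' := ∑ b, wordLength T (ψ b)
  have hM : ∀ b, ℓ (ψ b) ≤ M := fun b =>
    Finset.single_le_sum (f := fun b => ℓ (ψ b)) (fun _ _ => Nat.zero_le _) (Finset.mem_univ b)
  have hM' : ∀ b, wordLength T (ψ b) ≤ M' := fun b =>
    Finset.single_le_sum (f := fun b => wordLength T (ψ b)) (fun _ _ => Nat.zero_le _)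
      (Finset.mem_univ b)
  -- The additive errors from the finite torsion part become multiplicative because `ℓ a ≥ 1` away
  -- from the identity.
  refine ⟨C * (1 + M) * c + M', fun a => ?_⟩
  rcases Nat.eq_zero_or_pos (ℓ a) with h | h
  · rw [(h1 a).1 h, wordLength_one]
    exact Nat.zero_le _
  obtain ⟨x, b, hab⟩ := hdec a
  have h2 : wordLength T (φ x) ≤ C * ℓ (φ x) * c :=
    apply_le_mul_sum_single (ℓ := fun x => wordLength T (φ x)) (by simp [hφ0, wordLength_one])
      (fun x y => by rw [hφadd]; exact wordLength_mul_le hT _ _)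
      (fun x => by rw [hφneg]; exact wordLength_inv_le hT _) x (hC x)
  have h3 : ℓ (φ x) ≤ ℓ a + M := by
    have : φ x = a * (ψ b)⁻¹ := by rw [hab, mul_inv_cancel_right]
    rw [this]
    exact (hmul _ _).trans (add_le_add le_rfl ((hinv _).trans (hM b)))
  have h4 : ℓ (φ x) ≤ (1 + M) * ℓ a := by nlinarith
  calc wordLength T a ≤ wordLength T (φ x) + wordLength T (ψ b) := by
        conv_lhs => rw [hab]
        exact wordLength_mul_le hT _ _
    _ ≤ C * ((1 + M) * ℓ a) * c + M' * ℓ a := by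
        refine add_le_add (h2.trans (by gcongr)) ((hM' b).trans (Nat.le_mul_of_pos_right _ h))
    _ = _ := by ring

end NIU

/-! ### Reduction to purely transcendental fields, and conclusion. -/

namespace NIU

theorem isAlgebraic_mvPolynomial_of_isTranscendenceBasis {k F σ : Type*} [CommRing k] [Nontrivial k]
    [CommRing F] [Algebra k F] {x : σ → F} (hx : IsTranscendenceBasis k x)
    [Algebra (MvPolynomial σ k) F]
    (h : algebraMap (MvPolynomial σ k) F = (MvPolynomial.aeval x : _ →ₐ[k] F)) (z : F) :
    IsAlgebraic (MvPolynomial σ k) z := by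
  have h1 := hx.isAlgebraic.isAlgebraic z
  refine h1.of_ringHom_of_comp_eq hx.1.aevalEquiv.toRingEquiv (RingHom.id F)
    hx.1.aevalEquiv.surjective Function.injective_id ?_
  ext p <;> simp [h]

/-- Restriction of scalars for matrices along a finite field extension. -/
theorem exists_injective_ringHom_matrix (E K : Type*) [Field E] [Field K] [Algebra E K]
    [FiniteDimensional E K] (d : Type*) [Fintype d] [DecidableEq d] :
    ∃ ψ : Matrix d d K →+* Matrix (d × Fin (Module.finrank E K)) (d × Fin (Module.finrank E K)) E,
      Function.Injective ψ :=
  ⟨(Matrix.compRingEquiv d (Fin (Module.finrank E K)) E).toRingHom.comp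
      (Algebra.leftMulMatrix (Module.finBasis E K)).toRingHom.mapMatrix,
    (Matrix.compRingEquiv d (Fin (Module.finrank E K)) E).injective.comp
      (Matrix.map_injective (Algebra.leftMulMatrix_injective (Module.finBasis E K)))⟩

/-- A representation over an arbitrary field, restricted to a finitely generated group, can be
replaced by one over a purely transcendental extension of the prime field. -/
theorem exists_representation_fractionRing (k : Type) [CommRing k] [IsDomain k] {F : Type v}
    [Field F] [Algebra k F] [FaithfulSMul k F] {G : Type u} [Group G] {S : Set G}
    (hSf : S.Finite) (hS : Subgroup.closure S = ⊤) {d : ℕ}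
    (ρ : G →* Matrix (Fin d) (Fin d) F) (hρ : ∀ g, IsNilpotent (ρ g - 1) → IsOfFinOrder g) :
    ∃ (σ : Type v) (r : ℕ) (ρ' : G →* Matrix (Fin d × Fin r) (Fin d × Fin r)
      (FractionRing (MvPolynomial σ k))), ∀ g, IsNilpotent (ρ' g - 1) → IsOfFinOrder g := by
  obtain ⟨σ, x, hx⟩ := exists_isTranscendenceBasis' k F
  let P := MvPolynomial σ k
  let E := FractionRing P
  let : Algebra P F := (MvPolynomial.aeval x : P →ₐ[k] F).toRingHom.toAlgebra
  have : FaithfulSMul P F := (faithfulSMul_iff_algebraMap_injective P F).2 hx.1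
  let : Algebra E F := FractionRing.liftAlgebra P F
  have : IsScalarTower P E F := FractionRing.isScalarTower_liftAlgebra P F
  have halg : ∀ z : F, IsIntegral E z := fun z =>
    isAlgebraic_iff_isIntegral.1 ((IsFractionRing.isAlgebraic_iff P E F).1
      (isAlgebraic_mvPolynomial_of_isTranscendenceBasis hx rfl z))
  let S' := {s | s ∈ S ∨ s⁻¹ ∈ S}
  have hS' : S'.Finite := hSf.union hSf.inv
  let X : Set F := ⋃ i, ⋃ j, (fun g => ρ g i j) '' S'
  have hX : X.Finite := Set.finite_iUnion fun i => Set.finite_iUnion fun j => hS'.image _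
  have : Finite X := hX
  -- Finitely many algebraic matrix entries generate a finite extension of `E`, so restriction of
  -- scalars keeps the dimension finite.
  let K := IntermediateField.adjoin E X
  have : FiniteDimensional E K := IntermediateField.finiteDimensional_adjoin fun z _ => halg z
  let Θ : Matrix (Fin d) (Fin d) K →+* Matrix (Fin d) (Fin d) F := (algebraMap K F).mapMatrix
  have hΘ : Function.Injective Θ := Matrix.map_injective (algebraMap K F).injective
  have hrange : ∀ g, ∃ M, Θ M = ρ g := by
    intro g
    obtain ⟨l, hl, rfl, -⟩ := exists_list_length_eq_wordLength hS g
    induction l with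
    | nil => exact ⟨1, by simp⟩
    | cons s l ih =>
      obtain ⟨M, hM⟩ := ih fun y hy => hl y (by simp [hy])
      have hs : ∀ i j, ρ s i j ∈ K := fun i j => IntermediateField.subset_adjoin E X
        (Set.mem_iUnion₂.2 ⟨i, j, s, hl s (by simp), rfl⟩)
      refine ⟨Matrix.of (fun i j => ⟨ρ s i j, hs i j⟩) * M, ?_⟩
      rw [List.prod_cons, map_mul, map_mul, hM]
      rfl
  choose τ hτ using hrange
  let ρK : G →* Matrix (Fin d) (Fin d) K :=
    { toFun := τ
      map_one' := hΘ (by rw [hτ, map_one, map_one])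
      map_mul' := fun g h => hΘ (by rw [hτ, map_mul, map_mul, hτ, hτ]) }
  obtain ⟨ψ, hψ⟩ := exists_injective_ringHom_matrix E K (Fin d)
  refine ⟨σ, Module.finrank E K, ψ.toMonoidHom.comp ρK, fun g hg => hρ g ?_⟩
  -- Injective ring homomorphisms reflect nilpotency, so unipotent images come only from unipotent
  -- matrices over `F`.
  have h1 : IsNilpotent (ψ (ρK g - 1)) := by
    rw [map_sub, map_one]
    exact hg
  have h2 := ((IsNilpotent.map_iff hψ).1 h1).map Θ
  rw [map_sub, map_one] at h2
  rw [← hτ g]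
  exact h2

theorem exists_le_mul_wordLength_pow_of_isNIULinear {G : Type u} [Group G]
    (hG : IsNIULinear.{u, v} G) {S : Set G} (hSf : S.Finite) (hS : Subgroup.closure S = ⊤) :
    ∃ N : ℕ, 0 < N ∧ ∀ g, ¬ IsOfFinOrder g → ∀ m, m ≤ N * wordLength S (g ^ m) := by
  obtain ⟨F, _, d, ρ, -, hinj, hniu⟩ := hG
  let ρ₁ : G →* Matrix (Fin d) (Fin d) F := (Units.coeHom _).comp ρ
  have hρ₁ : ∀ g, IsNilpotent (ρ₁ g - 1) → IsOfFinOrder g := fun g hg =>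
    hinj.isOfFinOrder_iff.1 (hniu (ρ g) ⟨g, rfl⟩ hg)
  obtain ⟨p, hp⟩ := CharP.exists F
  rcases CharP.char_is_prime_or_zero F p with hpp | rfl
  · have : Fact p.Prime := ⟨hpp⟩
    let := ZMod.algebra F p
    have : FaithfulSMul (ZMod p) F :=
      (faithfulSMul_iff_algebraMap_injective _ _).2 (algebraMap (ZMod p) F).injective
    obtain ⟨σ, r, ρ', hρ'⟩ := exists_representation_fractionRing (ZMod p) hSf hS ρ₁ hρ₁
    exact exists_le_mul_wordLength_pow (P := MvPolynomial σ (ZMod p)) ρ' hρ'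
      (fun f hf s hs => exists_finite_charpoly_of_charP p hf hs) hSf hS
  -- The base is `ℤ` rather than `ℚ`: the argument needs nonzero values of size at least one and
  -- finitely many values in a bounded range.
  · have : CharZero F := CharP.charP_to_charZero F
    have : FaithfulSMul ℤ F :=
      (faithfulSMul_iff_algebraMap_injective _ _).2 (RingHom.injective_int (algebraMap ℤ F))
    obtain ⟨σ, r, ρ', hρ'⟩ := exists_representation_fractionRing ℤ hSf hS ρ₁ hρ₁
    exact exists_le_mul_wordLength_pow (P := MvPolynomial σ ℤ) ρ' hρ'
      (fun f hf s hs => exists_finite_charpoly_of_int hf hs) hSf hS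

end NIU

theorem mainTheorem1 (G : Type u) [Group G] [Group.FG G]
    (hG : NIU.IsNIULinear.{u, v} G)
    (A : Subgroup G) (hAfg : A.FG) (hAab : ∀ x ∈ A, ∀ y ∈ A, x * y = y * x) :
    NIU.IsUndistorted A := by
  intro S hSf hS T hTf hT
  obtain ⟨N, -, hN⟩ := NIU.exists_le_mul_wordLength_pow_of_isNIULinear hG hSf hS
  let : CommGroup A :=
    { (inferInstance : Group A) with
      mul_comm := fun a b => Subtype.ext (hAab a a.2 b b.2) }
  obtain ⟨C, hC⟩ := NIU.exists_wordLength_le_mul hTf hT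
    (ℓ := fun a : A => NIU.wordLength S (a : G))
    (fun a => ⟨fun h => Subtype.ext (NIU.eq_one_of_wordLength_eq_zero hS h),
      fun h => by rw [h]; exact NIU.wordLength_one⟩)
    (fun a b => NIU.wordLength_mul_le hS a b) (fun a => NIU.wordLength_inv_le hS a)
    (N := N) (fun a ha m => hN a (fun h => ha (Submonoid.isOfFinOrder_coe.1 h)) m)
  refine ⟨C + 1, by positivity, fun a => ?_⟩
  have h : NIU.wordLength T a ≤ (C + 1) * NIU.wordLength S (a : G) :=
    (hC a).trans (Nat.mul_le_mul_right _ (Nat.le_succ C))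
  exact_mod_cast h
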